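/- All rings are associative and not necessarily unital, and all ideals are two-sided. A ring $R$ has local units if for every finite set $F\subseteq R$ there is an idempotent $e\in R$ with $er=re=r$ for all $r\in F$. Let $R$ be a ring with local units and let $\alpha:R\to R$ be a ring automorphism. The crossed product $R\times_\alpha\mathbb{Z}$ is the ring of finite formal sums $\sum_{n\in\mathbb{Z}} r_n t^n$ with $r_n\in R$, with coefficientwise addition and with the biadditive product determined by $(rt^m)(st^n)=r\,\alpha^m(s)\,t^{m+n}$. A ring is simple if it is non-zero and its only ideals are $\{0\}$ and itself. The multiplier ring $\mathcal{M}(R)$ is the ring of all pairs $(f,g)$ of additive maps $f,g:R\to R$ such that $f(xy)=f(x)y$, $g(xy)=xg(y)$ and $xf(y)=g(x)y$ for all $x,y\in R$, with componentwise addition and with product $(f_1,g_1)(f_2,g_2)=(f_1\circ f_2,\,g_2\circ g_1)$; its unit is $1=(\mathrm{id},\mathrm{id})$. The ring $R$ is regarded as an ideal of $\mathcal{M}(R)$ by identifying $r$ with $(s\mapsto rs,\ s\mapsto sr)$, so that $ur=f(r)$ and $ru=g(r)$ for $u=(f,g)\in\mathcal{M}(R)$ and $r\in R$. For a positive integer $n$,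 $\alpha$ is inner with periodicity $n$ if there are $u,v\in\mathcal{M}(R)$ such that $vu=1$ and, for all $r\in R$, $\alpha^n(r)=urv$ and $\alpha(ur)=u\alpha(r)$. The automorphism $\alpha$ is outer if it is not inner with periodicity $n$ for any positive integer $n$. An ideal $I$ of $R$ is strongly $\alpha$-invariant if $\alpha(I)\subseteq I$ and $\alpha(R)I\alpha(R)\subseteq\alpha(I)$. Then the following two statements are equivalent: 1. The crossed product $R\times_\alpha\mathbb{Z}$ is simple. 2. The automorphism $\alpha$ is outer and the only strongly $\alpha$-invariant ideals in $R$ are $\{0\}$ and $R$. -/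

import Mathlib

namespace LocalUnitsRing

/-- A (not necessarily unital) ring has local units if every finite subset has a two-sided
identity which is an idempotent of the ring. -/
def HasLocalUnits (R : Type*) [NonUnitalRing R] : Prop :=
  ∀ F : Finset R, ∃ e : R, e * e = e ∧ ∀ r ∈ F, e * r = r ∧ r * e = r

/-- The multiplier ring `M(R)`: the ring of double centralizers `(f, g)`, where `f` is a right
`R`-module endomorphism and `g` is a left `R`-module endomorphism of `R` with
`r₁ f(r₂) = g(r₁) r₂`. Addition is componentwise and the product is
`(f₁, g₁) (f₂, g₂) = (f₁ ∘ f₂, g₂ ∘ g₁)`, which is why the second component lives in the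
opposite of the endomorphism ring. The unit is `(id, id)`. -/
def multiplierRing (R : Type*) [NonUnitalRing R] :
    Subring (AddMonoid.End R × (AddMonoid.End R)ᵐᵒᵖ) where
  carrier := {p | (∀ x y : R, p.1 (x * y) = p.1 x * y) ∧
    (∀ x y : R, p.2.unop (x * y) = x * p.2.unop y) ∧
    (∀ x y : R, x * p.1 y = p.2.unop x * y)}
  mul_mem' := by
    rintro a b ⟨ha₁, ha₂, ha₃⟩ ⟨hb₁, hb₂, hb₃⟩
    refine ⟨fun x y => ?_, fun x y => ?_, fun x y => ?_⟩
    · simp [ha₁, hb₁]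
    · simp [ha₂, hb₂]
    · simp [ha₃, hb₃]
  one_mem' := by
    refine ⟨fun x y => ?_, fun x y => ?_, fun x y => ?_⟩ <;> simp
  add_mem' := by
    rintro a b ⟨ha₁, ha₂, ha₃⟩ ⟨hb₁, hb₂, hb₃⟩
    refine ⟨fun x y => ?_, fun x y => ?_, fun x y => ?_⟩
    · change a.1 (x * y) + b.1 (x * y) = (a.1 x + b.1 x) * y
      rw [ha₁, hb₁, add_mul]
    · change a.2.unop (x * y) + b.2.unop (x * y) = x * (a.2.unop y + b.2.unop y)
      rw [ha₂, hb₂, mul_add]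
    · change x * (a.1 y + b.1 y) = (a.2.unop x + b.2.unop x) * y
      rw [mul_add, ha₃, hb₃, add_mul]
  zero_mem' := by
    refine ⟨fun x y => ?_, fun x y => ?_, fun x y => ?_⟩ <;> simp
  neg_mem' := by
    rintro a ⟨ha₁, ha₂, ha₃⟩
    refine ⟨fun x y => ?_, fun x y => ?_, fun x y => ?_⟩
    · change -a.1 (x * y) = -a.1 x * y
      rw [ha₁, neg_mul]
    · change -a.2.unop (x * y) = x * -a.2.unop y
      rw [ha₂, mul_neg]
    · change x * -a.1 y = -a.2.unop x * y
      rw [mul_neg, ha₃, neg_mul]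

namespace multiplierRing

variable {R : Type*} [NonUnitalRing R]

/-- The element `u r = f(r)` of `R`, for `u = (f, g)` in `M(R)` and `r` in `R`. -/
def lact (u : multiplierRing R) (r : R) : R := u.1.1 r

/-- The element `r u = g(r)` of `R`, for `u = (f, g)` in `M(R)` and `r` in `R`. -/
def ract (r : R) (u : multiplierRing R) : R := u.1.2.unop r

/-- The canonical map `ι : R → M(R)`, `ι(r) = (s ↦ r s, s ↦ s r)`. -/
def incl (r : R) : multiplierRing R :=
  ⟨(AddMonoidHom.mulLeft r, MulOpposite.op (AddMonoidHom.mulRight r)),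
    ⟨fun x y => (mul_assoc r x y).symm, fun x y => mul_assoc x y r,
      fun x y => (mul_assoc x r y).symm⟩⟩

/-- `lact` is left multiplication by a multiplier inside `M(R)`. -/
theorem incl_lact (u : multiplierRing R) (r : R) : incl (lact u r) = u * incl r := by
  refine Subtype.ext (Prod.ext ?_ (MulOpposite.unop_injective ?_))
  · ext s
    exact (u.2.1 r s).symm
  · ext s
    exact u.2.2.2 s r

/-- `ract` is right multiplication by a multiplier inside `M(R)`. -/
theorem incl_ract (r : R) (u : multiplierRing R) : incl (ract r u) = incl r * u := by
  refine Subtype.ext (Prod.ext ?_ (MulOpposite.unop_injective ?_))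
  · ext s
    exact (u.2.2.2 r s).symm
  · ext s
    exact (u.2.2.1 s r).symm

end multiplierRing

open multiplierRing in
/-- `α` is inner with periodicity `n`: there are `u, v ∈ M(R)` with `v u = 1`,
`αⁿ(r) = u r v` and `α(u r) = u α(r)` for all `r ∈ R`. -/
def IsInnerWithPeriodicity {R : Type*} [NonUnitalRing R] (α : R →ₙ+* R) (n : ℕ) : Prop :=
  ∃ u v : multiplierRing R, v * u = 1 ∧
    (∀ r : R, α^[n] r = ract (lact u r) v) ∧
    (∀ r : R, α (lact u r) = lact u (α r))

/-- `α` is outer if it is not inner with periodicity `n` for any positive integer `n`. -/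
def IsOuter {R : Type*} [NonUnitalRing R] (α : R →ₙ+* R) : Prop :=
  ∀ n : ℕ, 0 < n → ¬ IsInnerWithPeriodicity α n

/-- A two-sided ideal `I` is strongly `α`-invariant if `α(I) ⊆ I` and
`α(R) I α(R) ⊆ α(I)`. -/
def IsStronglyInvariant {R : Type*} [NonUnitalRing R] (α : R →ₙ+* R)
    (I : TwoSidedIdeal R) : Prop :=
  (∀ x ∈ I, α x ∈ I) ∧ ∀ r s : R, ∀ x ∈ I, ∃ y ∈ I, α y = α r * x * α s

/-- The underlying type of the crossed product `R ×_α ℤ`: the finite formal sums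
`∑ₙ rₙ tⁿ` with `n ∈ ℤ` and `rₙ ∈ R`, encoded by their coefficients. -/
def CrossedProduct {R : Type*} [NonUnitalRing R] (_α : R ≃+* R) : Type _ := ℤ →₀ R

namespace CrossedProduct

variable {R : Type*} [NonUnitalRing R] (α : R ≃+* R)

/-- The `n`-th power of `α` in the group of ring automorphisms, for `n ∈ ℤ`. -/
def autPow (n : ℤ) : R ≃+* R := (show RingAut R from α) ^ n

theorem autPow_add (m n : ℤ) (r : R) : autPow α (m + n) r = autPow α m (autPow α n r) := by
  unfold autPow
  rw [zpow_add]
  rfl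

/-- The product of finite formal sums given by `(r tᵐ) (s tⁿ) = r αᵐ(s) tᵐ⁺ⁿ`. -/
noncomputable def convMul (f g : ℤ →₀ R) : ℤ →₀ R :=
  f.sum fun m r => g.sum fun n s => Finsupp.single (m + n) (r * autPow α m s)

theorem convMul_single (m n : ℤ) (r s : R) :
    convMul α (Finsupp.single m r) (Finsupp.single n s) =
      Finsupp.single (m + n) (r * autPow α m s) := by
  simp [convMul]

theorem convMul_add (f g h : ℤ →₀ R) :
    convMul α f (g + h) = convMul α f g + convMul α f h := by
  unfold convMul
  rw [← Finsupp.sum_add]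
  refine Finsupp.sum_congr fun m _ => ?_
  exact Finsupp.sum_add_index' (by simp) (by simp [mul_add])

theorem add_convMul (f g h : ℤ →₀ R) :
    convMul α (f + g) h = convMul α f h + convMul α g h := by
  unfold convMul
  refine Finsupp.sum_add_index' (by simp) fun m r s => ?_
  rw [← Finsupp.sum_add]
  exact Finsupp.sum_congr fun n _ => by rw [add_mul, Finsupp.single_add]

theorem zero_convMul (f : ℤ →₀ R) : convMul α 0 f = 0 := by simp [convMul]

theorem convMul_zero (f : ℤ →₀ R) : convMul α f 0 = 0 := by simp [convMul]

theorem convMul_assoc (f g h : ℤ →₀ R) :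
    convMul α (convMul α f g) h = convMul α f (convMul α g h) := by
  induction f using Finsupp.induction_linear with
  | zero => simp only [zero_convMul]
  | add f₁ f₂ h₁ h₂ => simp only [add_convMul, h₁, h₂]
  | single m r =>
    induction g using Finsupp.induction_linear with
    | zero => simp only [zero_convMul, convMul_zero]
    | add g₁ g₂ h₁ h₂ => simp only [add_convMul, convMul_add, h₁, h₂]
    | single n s =>
      induction h using Finsupp.induction_linear with
      | zero => simp only [convMul_zero]
      | add k₁ k₂ h₁ h₂ => simp only [convMul_add, h₁, h₂]
      | single k u =>
        simp only [convMul_single, autPow_add, map_mul, mul_assoc, add_assoc]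

/-- The crossed product `R ×_α ℤ` as a ring, with coefficientwise addition and with the
product determined by `(r tᵐ) (s tⁿ) = r αᵐ(s) tᵐ⁺ⁿ`. -/
noncomputable instance : NonUnitalRing (CrossedProduct α) :=
  { (inferInstance : AddCommGroup (ℤ →₀ R)) with
    mul := convMul α
    left_distrib := convMul_add α
    right_distrib := add_convMul α
    zero_mul := zero_convMul α
    mul_zero := convMul_zero α
    mul_assoc := convMul_assoc α }

end CrossedProduct

end LocalUnitsRing

/-!
The proof rests on a reformulation of innerness which does not mention multipliers. A *twist* of
period `n` is an additive bijection `h : R → R` with `h (r s) = r h(s) = h(r) αⁿ(s)` and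
`h ∘ α = α ∘ h`; over a ring with local units `α` is inner with periodicity `n` if and only if it
has a twist of period `n` (`IsTwist.isInnerWithPeriodicity`,
`IsInnerWithPeriodicity.exists_isTwist`), the twist attached to `(u, v)` being right multiplication
by `v`. Moreover a strongly invariant ideal is simply one stable under `α`
and `α⁻¹`.

If `α` has a twist `h` of period `n > 0`, then `r tᵐ ↦ h(r) tᵐ⁺ⁿ` is (multiplication by) a central
multiplier `z` of the crossed product, so the multiples of `1 - z` form an ideal. It is non-zero,
and it is proper because a non-zero `x - z x` has at least two non-zero coefficients
(`IsTwist.not_isSimpleRing`). A strongly invariant ideal `I` gives the ideal of elements with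
coefficients in `I` (`extendedIdeal`). This handles one direction.

Conversely, let `J` be a non-zero ideal of the crossed product, and let `n` be minimal such that
`J` has a non-zero element supported in `[0, n]`. The coefficients in a fixed degree of such
elements form a strongly invariant ideal (`coeffIdeal`). By minimality, such an element is
determined by its coefficient in degree `0`, and also by that in degree `n`; hence if `R` has no
non-trivial strongly invariant ideals, both coefficient maps are bijections onto `R`. If `n = 0`
then `J` contains `R`, so it is everything. If `n > 0` then the passage from the lowest to the
highest coefficient is a twist of period `n` (`exists_isTwist_of_bijective`), so `α` is not outer.
-/

namespace LocalUnitsRing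

/-! ### Iterates of the automorphism and strongly invariant ideals -/

section Automorphism

variable {R : Type*} [NonUnitalRing R] (α : R ≃+* R)

open CrossedProduct

@[simp] theorem autPow_zero (r : R) : autPow α 0 r = r := rfl

@[simp] theorem autPow_one (r : R) : autPow α 1 r = α r := by
  simp [autPow]

theorem autPow_neg_one (r : R) : autPow α (-1) r = α.symm r := by
  rw [autPow, zpow_neg_one]
  rfl

@[simp] theorem autPow_autPow_neg (k : ℤ) (r : R) : autPow α k (autPow α (-k) r) = r := by
  rw [← autPow_add, add_neg_cancel, autPow_zero]

theorem iterate_eq_autPow (n : ℕ) (r : R) : (α : R →ₙ+* R)^[n] r = autPow α n r := by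
  induction n with
  | zero => simp
  | succ n ih =>
    rw [Function.iterate_succ_apply', ih, Nat.cast_succ, add_comm, autPow_add, autPow_one]
    rfl

/-- A map commuting with `α` commutes with all integral powers of `α`. -/
theorem map_autPow_of_map_aut {h : R → R} (hα : ∀ r, h (α r) = α (h r)) (k : ℤ) (r : R) :
    h (autPow α k r) = autPow α k (h r) := by
  induction k using Int.induction_on generalizing r with
  | zero => simp
  | succ k ih => rw [autPow_add, autPow_add, ih, autPow_one, autPow_one, hα]
  | pred k ih =>
    rw [sub_eq_add_neg, autPow_add, autPow_add, ih, autPow_neg_one, autPow_neg_one]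
    congr 1
    rw [RingEquiv.eq_symm_apply, ← hα, RingEquiv.apply_symm_apply]

variable {α}

theorem isStronglyInvariant_of_symm_mem {I : TwoSidedIdeal R} (h : ∀ x ∈ I, α x ∈ I)
    (h' : ∀ x ∈ I, α.symm x ∈ I) : IsStronglyInvariant (α : R →ₙ+* R) I :=
  ⟨h, fun r s x hx => ⟨α.symm (α r * x * α s),
    h' _ (I.mul_mem_right _ _ (I.mul_mem_left _ _ hx)), α.apply_symm_apply _⟩⟩

theorem IsStronglyInvariant.symm_mem (hR : HasLocalUnits R) {I : TwoSidedIdeal R}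
    (hI : IsStronglyInvariant (α : R →ₙ+* R) I) {x : R} (hx : x ∈ I) : α.symm x ∈ I := by
  obtain ⟨e, -, he⟩ := hR {x}
  obtain ⟨h₁, h₂⟩ := he x (Finset.mem_singleton_self x)
  obtain ⟨y, hy, hyx⟩ := hI.2 (α.symm e) (α.symm e) x hx
  have hyx' : α y = x := by
    simpa [h₁, h₂] using hyx
  rwa [← hyx', α.symm_apply_apply]

theorem IsStronglyInvariant.autPow_mem (hR : HasLocalUnits R) {I : TwoSidedIdeal R}
    (hI : IsStronglyInvariant (α : R →ₙ+* R) I) (k : ℤ) {x : R} (hx : x ∈ I) :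
    autPow α k x ∈ I := by
  induction k using Int.induction_on generalizing x with
  | zero => simpa
  | succ k ih =>
    rw [autPow_add, autPow_one]
    exact ih (hI.1 x hx)
  | pred k ih =>
    rw [sub_eq_add_neg, autPow_add, autPow_neg_one]
    exact ih (hI.symm_mem hR hx)

end Automorphism

/-! ### Twists and innerness -/

section Twist

variable {R : Type*} [NonUnitalRing R]

open CrossedProduct multiplierRing

/-- A twist of period `n`: an additive bijection `h` commuting with `α` which is left `R`-linear,
and right `R`-linear up to `αⁿ`. It is the multiplier-free form of the right multiplication by `v`
when `αⁿ(r) = u r v`. -/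
structure IsTwist (α : R ≃+* R) (n : ℕ) (h : R ≃+ R) : Prop where
  map_mul_left : ∀ r s, h (r * s) = r * h s
  map_mul_right : ∀ r s, h (r * s) = h r * autPow α n s
  map_aut : ∀ r, h (α r) = α (h r)

variable {α : R ≃+* R} {n : ℕ}

theorem HasLocalUnits.eq_of_mul_left_eq (hR : HasLocalUnits R) {a b : R}
    (h : ∀ y, y * a = y * b) : a = b := by
  classical
  obtain ⟨e, -, he⟩ := hR {a, b}
  rw [← (he a (by simp)).1, h, (he b (by simp)).1]

/-- The multiplier with right action `h` has left action `h ∘ α⁻ⁿ`; its inverse has right action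
`h⁻¹` and left action `αⁿ ∘ h⁻¹`. -/
theorem IsTwist.isInnerWithPeriodicity {h : R ≃+ R} (hh : IsTwist α n h) :
    IsInnerWithPeriodicity (α : R →ₙ+* R) n := by
  have hl : ∀ r s, h.symm (r * s) = r * h.symm s := fun r s => by
    rw [h.symm_apply_eq, hh.map_mul_left, h.apply_symm_apply]
  have hr : ∀ r s, h.symm (r * autPow α n s) = h.symm r * s := fun r s => by
    rw [h.symm_apply_eq, hh.map_mul_right, h.apply_symm_apply]
  have hc : ∀ r, h.symm (α r) = α (h.symm r) := fun r => by
    rw [h.symm_apply_eq, hh.map_aut, h.apply_symm_apply]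
  have hs : ∀ s, autPow α n ((autPow α n).symm s) = s := (autPow α n).apply_symm_apply
  let v : multiplierRing R :=
    ⟨(h.toAddMonoidHom.comp (autPow α n).symm.toAddEquiv.toAddMonoidHom,
      MulOpposite.op h.toAddMonoidHom), by
      refine ⟨fun x y => ?_, fun x y => hh.map_mul_left x y, fun x y => ?_⟩
      · change h ((autPow α n).symm (x * y)) = h ((autPow α n).symm x) * y
        rw [map_mul, hh.map_mul_right, hs]
      · change x * h ((autPow α n).symm y) = h x * y
        rw [← hh.map_mul_left, hh.map_mul_right, hs]⟩
  let u : multiplierRing R :=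
    ⟨((autPow α n).toAddEquiv.toAddMonoidHom.comp h.symm.toAddMonoidHom,
      MulOpposite.op h.symm.toAddMonoidHom), by
      have key : ∀ x y, x * autPow α n (h.symm y) = h.symm x * y := fun x y => by
        apply h.injective
        rw [hh.map_mul_left, hh.map_mul_right, map_autPow_of_map_aut α hh.map_aut,
          h.apply_symm_apply, h.apply_symm_apply]
      refine ⟨fun x y => ?_, fun x y => hl x y, fun x y => key x y⟩
      change autPow α n (h.symm (x * y)) = autPow α n (h.symm x) * y
      rw [← map_autPow_of_map_aut α hc, ← map_autPow_of_map_aut α hc, map_mul, hr]⟩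
  refine ⟨u, v, ?_, fun r => ?_, fun r => ?_⟩
  · refine Subtype.ext (Prod.ext ?_ (MulOpposite.unop_injective ?_))
    · ext s
      change h ((autPow α n).symm (autPow α n (h.symm s))) = s
      simp
    · ext s
      change h.symm (h s) = s
      simp
  · rw [iterate_eq_autPow]
    change autPow α n r = h (autPow α n (h.symm r))
    rw [map_autPow_of_map_aut α hh.map_aut, h.apply_symm_apply]
  · change α (autPow α n (h.symm r)) = autPow α n (h.symm (α r))
    rw [hc, map_autPow_of_map_aut α (h := α) fun _ => rfl]

/-- If `αⁿ(r) = u r v` with `v u = 1`, then `u v = 1` too, because `αⁿ` is surjective; hence right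
multiplication by `v` is bijective. -/
theorem IsInnerWithPeriodicity.exists_isTwist (hR : HasLocalUnits R)
    (hα : IsInnerWithPeriodicity (α : R →ₙ+* R) n) : ∃ h : R ≃+ R, IsTwist α n h := by
  obtain ⟨u, v, hvu, hn, hu⟩ := hα
  have hvl : ∀ x, lact v (lact u x) = x := fun x =>
    congrArg (fun w : multiplierRing R => lact w x) hvu
  have hvr : ∀ x, ract (ract x v) u = x := fun x =>
    congrArg (fun w : multiplierRing R => ract x w) hvu
  have hcomm : ∀ (w z : multiplierRing R) (x : R),
      ract (lact w x) z = lact w (ract x z) := fun w z x => by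
    refine hR.eq_of_mul_left_eq fun y => ?_
    have h₁ : y * ract (lact w x) z = ract (y * lact w x) z := (z.2.2.1 _ _).symm
    have h₂ : y * lact w x = ract y w * x := w.2.2.2 _ _
    have h₃ : y * lact w (ract x z) = ract y w * ract x z := w.2.2.2 _ _
    have h₄ : ract (ract y w * x) z = ract y w * ract x z := z.2.2.1 _ _
    rw [h₁, h₂, h₃, h₄]
  have hn' : ∀ r, autPow α n r = ract (lact u r) v := fun r => by
    rw [← iterate_eq_autPow, hn]
  have huv : ∀ x, lact u (lact v x) = x := fun x => by
    obtain ⟨r, rfl⟩ := (autPow α n).surjective x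
    rw [hn', hcomm, hvl]
  have hvα : ∀ x, α (lact v x) = lact v (α x) := fun x => by
    have h := hu (lact v x)
    change α (lact u (lact v x)) = lact u (α (lact v x)) at h
    rw [huv] at h
    rw [h, hvl]
  have hv : ∀ s, lact v (autPow α n s) = ract s v := fun s => by
    rw [hn', hcomm, hvl]
  have hbij : Function.Bijective (v.1.2.unop : R →+ R) := by
    refine ⟨fun x y hxy => ?_, fun x => ?_⟩
    · rw [← hvr x, ← hvr y]
      exact congrArg (fun r => ract r u) hxy
    · obtain ⟨r, rfl⟩ := (autPow α n).surjective x
      exact ⟨lact u r, (hn' r).symm⟩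
  refine ⟨AddEquiv.ofBijective (v.1.2.unop : R →+ R) hbij, v.2.2.1, fun r s => ?_, fun r => ?_⟩
  · change ract (r * s) v = ract r v * autPow α n s
    have h₁ : ract (r * s) v = r * ract s v := v.2.2.1 _ _
    have h₂ : r * lact v (autPow α n s) = ract r v * autPow α n s := v.2.2.2 _ _
    rw [h₁, ← h₂, hv]
  · change ract (α r) v = α (ract r v)
    rw [← hv, ← hv, hvα, ← map_autPow_of_map_aut α (h := α) fun _ => rfl]

/-- Over the zero ring, every automorphism is inner. -/
theorem IsOuter.nontrivial (hα : IsOuter (α : R →ₙ+* R)) : Nontrivial R := by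
  by_contra hR
  rw [not_nontrivial_iff_subsingleton] at hR
  refine hα 1 one_pos (IsTwist.isInnerWithPeriodicity (h := AddEquiv.refl R) ?_)
  exact ⟨fun _ _ => Subsingleton.elim _ _, fun _ _ => Subsingleton.elim _ _,
    fun _ => Subsingleton.elim _ _⟩

end Twist

/-! ### Coefficients and monomials of the crossed product -/

namespace CrossedProduct

variable {R : Type*} [NonUnitalRing R] {α : R ≃+* R}

variable (α) in
/-- The coefficient `rₘ` of `∑ₙ rₙ tⁿ`, as an additive map. -/
def coeff (m : ℤ) : CrossedProduct α →+ R := Finsupp.applyAddHom (M := R) m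

variable (α) in
/-- The monomial `r tᵏ`. -/
noncomputable def mono (k : ℤ) (r : R) : CrossedProduct α := (Finsupp.single k r : ℤ →₀ R)

theorem ext_coeff {x y : CrossedProduct α} (h : ∀ m, coeff α m x = coeff α m y) : x = y :=
  Finsupp.ext h

/-- A non-zero element has a lowest degree `L` and a highest degree `M`. -/
theorem exists_lowest_highest {x : CrossedProduct α} (hx : x ≠ 0) :
    ∃ L M, coeff α L x ≠ 0 ∧ coeff α M x ≠ 0 ∧ ∀ m, coeff α m x ≠ 0 → L ≤ m ∧ m ≤ M := by
  have hne : (Finsupp.support (M := R) x).Nonempty := Finsupp.support_nonempty_iff.2 hx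
  obtain ⟨M, hM, hMmax⟩ := Finset.exists_max_image _ id hne
  obtain ⟨L, hL, hLmin⟩ := Finset.exists_min_image _ id hne
  exact ⟨L, M, Finsupp.mem_support_iff.1 hL, Finsupp.mem_support_iff.1 hM, fun m hm =>
    ⟨hLmin m (Finsupp.mem_support_iff.2 hm), hMmax m (Finsupp.mem_support_iff.2 hm)⟩⟩

theorem coeff_mono (m k : ℤ) (r : R) : coeff α m (mono α k r) = if k = m then r else 0 :=
  Finsupp.single_apply

theorem mono_mul_mono (m n : ℤ) (r s : R) :
    mono α m r * mono α n s = mono α (m + n) (r * autPow α m s) :=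
  convMul_single α m n r s

@[elab_as_elim]
theorem induction_mono {p : CrossedProduct α → Prop} (x : CrossedProduct α) (zero : p 0)
    (add : ∀ x y, p x → p y → p (x + y)) (mono : ∀ k r, p (mono α k r)) : p x :=
  Finsupp.induction_linear (motive := p) x zero add mono

theorem coeff_mono_mul (m k : ℤ) (a : R) (x : CrossedProduct α) :
    coeff α m (mono α k a * x) = a * autPow α k (coeff α (m - k) x) := by
  induction x using induction_mono with
  | zero => simp
  | add x y hx hy => rw [mul_add, map_add, hx, hy, map_add, map_add, mul_add]
  | mono n s =>
    rw [mono_mul_mono, coeff_mono, coeff_mono]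
    by_cases h : n = m - k
    · rw [if_pos h, if_pos (by omega)]
    · rw [if_neg h, if_neg (by omega), map_zero, mul_zero]

theorem coeff_mul_mono (m k : ℤ) (b : R) (x : CrossedProduct α) :
    coeff α m (x * mono α k b) = coeff α (m - k) x * autPow α (m - k) b := by
  induction x using induction_mono with
  | zero => simp
  | add x y hx hy => rw [add_mul, map_add, hx, hy, map_add, add_mul]
  | mono n s =>
    rw [mono_mul_mono, coeff_mono, coeff_mono]
    by_cases h : n = m - k
    · rw [if_pos h, if_pos (by omega), h]
    · rw [if_neg h, if_neg (by omega), zero_mul]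

/-! ### Construction of ideals of the crossed product -/

/-- An additive subgroup of the crossed product stable under multiplication by monomials, as an
ideal. -/
noncomputable def idealOfMono (S : AddSubgroup (CrossedProduct α))
    (hl : ∀ k a, ∀ x ∈ S, mono α k a * x ∈ S) (hr : ∀ k b, ∀ x ∈ S, x * mono α k b ∈ S) :
    TwoSidedIdeal (CrossedProduct α) :=
  .mk' S S.zero_mem S.add_mem S.neg_mem
    (fun {x y} hy => by
      induction x using induction_mono with
      | zero => simp [S.zero_mem]
      | add x x' hx hx' =>
        rw [add_mul]
        exact S.add_mem hx hx'
      | mono k a => exact hl k a y hy)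
    (fun {x y} hx => by
      induction y using induction_mono with
      | zero => simp [S.zero_mem]
      | add y y' hy hy' =>
        rw [mul_add]
        exact S.add_mem hy hy'
      | mono k a => exact hr k a x hx)

theorem mem_idealOfMono {S : AddSubgroup (CrossedProduct α)} {hl hr} {x : CrossedProduct α} :
    x ∈ idealOfMono S hl hr ↔ x ∈ S :=
  TwoSidedIdeal.mem_mk' _ _ _ _ _ _ _

/-- The ideal of the elements of the crossed product with coefficients in a strongly invariant
ideal. -/
noncomputable def extendedIdeal (hR : HasLocalUnits R) (I : TwoSidedIdeal R)
    (hI : IsStronglyInvariant (α : R →ₙ+* R) I) : TwoSidedIdeal (CrossedProduct α) :=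
  idealOfMono
    { carrier := {x | ∀ m, coeff α m x ∈ I}
      zero_mem' := fun m => by
        rw [map_zero]
        exact I.zero_mem
      add_mem' := fun hx hy m => by
        rw [map_add]
        exact I.add_mem (hx m) (hy m)
      neg_mem' := fun hx m => by
        rw [map_neg]
        exact I.neg_mem (hx m) }
    (fun k a x hx m => by
      rw [coeff_mono_mul]
      exact I.mul_mem_left _ _ (hI.autPow_mem hR k (hx _)))
    (fun k b x hx m => by
      rw [coeff_mul_mono]
      exact I.mul_mem_right _ _ (hx _))

theorem mem_extendedIdeal {hR : HasLocalUnits R} {I : TwoSidedIdeal R}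
    {hI : IsStronglyInvariant (α : R →ₙ+* R) I} {x : CrossedProduct α} :
    x ∈ extendedIdeal hR I hI ↔ ∀ m, coeff α m x ∈ I :=
  mem_idealOfMono

theorem eq_bot_or_eq_top_of_isSimpleRing (hR : HasLocalUnits R)
    (hS : IsSimpleRing (CrossedProduct α)) (I : TwoSidedIdeal R)
    (hI : IsStronglyInvariant (α : R →ₙ+* R) I) : I = ⊥ ∨ I = ⊤ := by
  have hmono : ∀ r, mono α 0 r ∈ extendedIdeal hR I hI ↔ r ∈ I := fun r => by
    rw [mem_extendedIdeal]
    refine ⟨fun h => by simpa [coeff_mono] using h 0, fun h m => ?_⟩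
    rw [coeff_mono]
    split_ifs
    exacts [h, I.zero_mem]
  refine (hS.simple.eq_bot_or_eq_top (extendedIdeal hR I hI)).imp (fun h => ?_) fun h => ?_
  · refine TwoSidedIdeal.ext fun r => ?_
    rw [← hmono, h, TwoSidedIdeal.mem_bot, TwoSidedIdeal.mem_bot]
    refine ⟨fun hr => ?_, fun hr => ?_⟩
    · simpa [coeff_mono] using congrArg (coeff α 0) hr
    · exact ext_coeff fun m => by simp [coeff_mono, hr]
  · refine TwoSidedIdeal.ext fun r => ?_
    rw [← hmono, h]
    exact ⟨fun _ => TwoSidedIdeal.mem_top _, fun _ => TwoSidedIdeal.mem_top _⟩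

variable (α) in
/-- The map `∑ rₘ tᵐ ↦ ∑ h(rₘ) tᵐ⁺ⁿ`. -/
noncomputable def shiftMap (n : ℕ) (h : R ≃+ R) : CrossedProduct α →+ CrossedProduct α :=
  (Finsupp.domCongr (M := R) (Equiv.addRight (n : ℤ))).toAddMonoidHom.comp
    (Finsupp.mapRange.addMonoidHom h.toAddMonoidHom)

theorem coeff_shiftMap (n : ℕ) (h : R ≃+ R) (m : ℤ) (x : CrossedProduct α) :
    coeff α m (shiftMap α n h x) = h (coeff α (m - n) x) := rfl

end CrossedProduct

open CrossedProduct

section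

variable {R : Type*} [NonUnitalRing R] {α : R ≃+* R} {n : ℕ} {h : R ≃+ R}

theorem IsTwist.mono_mul_shiftMap (hh : IsTwist α n h) (k : ℤ) (a : R) (x : CrossedProduct α) :
    mono α k a * shiftMap α n h x = shiftMap α n h (mono α k a * x) := by
  refine ext_coeff fun m => ?_
  rw [coeff_shiftMap, coeff_mono_mul, coeff_mono_mul, coeff_shiftMap, hh.map_mul_left,
    map_autPow_of_map_aut α hh.map_aut, sub_right_comm]

theorem IsTwist.shiftMap_mul_mono (hh : IsTwist α n h) (k : ℤ) (b : R) (x : CrossedProduct α) :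
    shiftMap α n h x * mono α k b = shiftMap α n h (x * mono α k b) := by
  refine ext_coeff fun m => ?_
  rw [coeff_shiftMap, coeff_mul_mono, coeff_mul_mono, coeff_shiftMap, hh.map_mul_right,
    ← autPow_add, sub_right_comm, sub_right_comm m n k, add_sub_cancel]

/-- The elements `x - z x`, where `z` is the central multiplier attached to the twist, form a proper
non-zero ideal. -/
theorem IsTwist.not_isSimpleRing [Nontrivial R] (hh : IsTwist α n h) (hn : 0 < n) :
    ¬ IsSimpleRing (CrossedProduct α) := by
  intro hS
  let J : TwoSidedIdeal (CrossedProduct α) := idealOfMono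
    (AddMonoidHom.id (CrossedProduct α) - shiftMap α n h).range
    (by
      rintro k a _ ⟨x, rfl⟩
      exact ⟨mono α k a * x, by simp [mul_sub, hh.mono_mul_shiftMap]⟩)
    (by
      rintro k b _ ⟨x, rfl⟩
      exact ⟨x * mono α k b, by simp [sub_mul, hh.shiftMap_mul_mono]⟩)
  have hJ : ∀ x, x ∈ J ↔ ∃ y, y - shiftMap α n h y = x := fun x => mem_idealOfMono
  obtain ⟨r, hr⟩ := exists_ne (0 : R)
  rcases hS.simple.eq_bot_or_eq_top J with hb | ht
  · have hmem := (hJ _).2 ⟨mono α 0 r, rfl⟩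
    rw [hb, TwoSidedIdeal.mem_bot] at hmem
    have h0 := congrArg (coeff α 0) hmem
    rw [map_sub, coeff_shiftMap, coeff_mono, coeff_mono, if_pos rfl, if_neg (by omega), map_zero,
      sub_zero, map_zero] at h0
    exact hr h0
  · obtain ⟨x, hx⟩ := (hJ (mono α 0 r)).1 (ht ▸ TwoSidedIdeal.mem_top _)
    have hc : ∀ m, m ≠ 0 → coeff α m x = h (coeff α (m - n) x) := fun m hm => by
      rw [← sub_eq_zero, ← coeff_shiftMap, ← map_sub, hx, coeff_mono, if_neg (Ne.symm hm)]
    have hx0 : x ≠ 0 := by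
      rintro rfl
      have h0 := congrArg (coeff α 0) hx
      rw [coeff_mono, if_pos rfl] at h0
      exact hr (h0.symm.trans (by simp))
    obtain ⟨L, M, hL', hM', hz⟩ := exists_lowest_highest hx0
    -- `x - z x` is non-zero both in degree `L` and in degree `M + n > L`; one of them is not `0`.
    have h1 : L = 0 := by
      by_contra hne
      have hLn : coeff α (L - n) x ≠ 0 := fun h0 => hL' (by rw [hc L hne, h0, map_zero])
      have := hz _ hLn
      omega
    have h2 : M + n = 0 := by
      by_contra hne
      have hMn : coeff α (M + n) x ≠ 0 := by
        rw [hc _ hne, add_sub_cancel_right]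
        simpa using hM'
      have := hz _ hMn
      omega
    have := hz _ hM'
    omega

end

/-! ### Elements of bounded support in an ideal of the crossed product -/

namespace CrossedProduct

variable {R : Type*} [NonUnitalRing R] {α : R ≃+* R}

theorem _root_.LocalUnitsRing.HasLocalUnits.exists_common_unit (hR : HasLocalUnits R)
    (x : CrossedProduct α) (φ : ℤ → R ≃+* R) :
    ∃ e : R, ∀ m, e * φ m (coeff α m x) = φ m (coeff α m x) ∧
      φ m (coeff α m x) * e = φ m (coeff α m x) := by
  classical
  obtain ⟨e, -, he⟩ := hR ((Finsupp.support (M := R) x).image fun m => φ m (coeff α m x))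
  refine ⟨e, fun m => ?_⟩
  by_cases hm : coeff α m x = 0
  · simp [hm]
  · exact he _ (Finset.mem_image_of_mem _ (Finsupp.mem_support_iff.2 hm))

/-- An ideal is stable under `x ↦ tᵏ x tⁱ⁻ᵏ`, although `t` need not lie in the crossed product. -/
theorem exists_mem_coeff_eq (hR : HasLocalUnits R) {J : TwoSidedIdeal (CrossedProduct α)}
    {x : CrossedProduct α} (hx : x ∈ J) (k i : ℤ) :
    ∃ y ∈ J, ∀ m, coeff α m y = autPow α k (coeff α (m - i) x) := by
  obtain ⟨e, he⟩ := hR.exists_common_unit x fun _ => autPow α k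
  obtain ⟨f, hf⟩ := hR.exists_common_unit x fun m => autPow α (-m)
  refine ⟨mono α k e * x * mono α (i - k) f,
    J.mul_mem_right _ _ (J.mul_mem_left _ _ hx), fun m => ?_⟩
  have hf' := congrArg (autPow α (m - i)) (hf (m - i)).2
  rw [map_mul, autPow_autPow_neg] at hf'
  rw [coeff_mul_mono, coeff_mono_mul, show m - (i - k) - k = m - i by ring, (he _).1,
    show m - (i - k) = k + (m - i) by ring, autPow_add, ← map_mul, hf']

/-- The elements of `J` supported in `[0, n]`. -/
def bounded (J : TwoSidedIdeal (CrossedProduct α)) (n : ℕ) : AddSubgroup (CrossedProduct α) where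
  carrier := {x | x ∈ J ∧ ∀ m : ℤ, m < 0 ∨ n < m → coeff α m x = 0}
  zero_mem' := ⟨J.zero_mem, fun m _ => map_zero _⟩
  add_mem' := fun hx hy => ⟨J.add_mem hx.1 hy.1, fun m hm => by
    rw [map_add, hx.2 m hm, hy.2 m hm, add_zero]⟩
  neg_mem' := fun hx => ⟨J.neg_mem hx.1, fun m hm => by rw [map_neg, hx.2 m hm, neg_zero]⟩

variable {J : TwoSidedIdeal (CrossedProduct α)} {n : ℕ} {x : CrossedProduct α}

theorem mono_mul_mem_bounded (hx : x ∈ bounded J n) (a : R) : mono α 0 a * x ∈ bounded J n :=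
  ⟨J.mul_mem_left _ _ hx.1, fun m hm => by
    rw [coeff_mono_mul, sub_zero, hx.2 m hm, map_zero, mul_zero]⟩

theorem mul_mono_mem_bounded (hx : x ∈ bounded J n) (b : R) : x * mono α 0 b ∈ bounded J n :=
  ⟨J.mul_mem_right _ _ hx.1, fun m hm => by
    rw [coeff_mul_mono, sub_zero, hx.2 m hm, zero_mul]⟩

theorem exists_mem_bounded_coeff_eq (hR : HasLocalUnits R) (hx : x ∈ bounded J n) (k : ℤ) :
    ∃ y ∈ bounded J n, ∀ m, coeff α m y = autPow α k (coeff α m x) := by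
  obtain ⟨y, hy, hyc⟩ := exists_mem_coeff_eq hR hx.1 k 0
  simp only [sub_zero] at hyc
  exact ⟨y, ⟨hy, fun m hm => by rw [hyc, hx.2 m hm, map_zero]⟩, hyc⟩

/-- The ideal of the coefficients in degree `c` of the elements of `J` supported in `[0, n]`. -/
def coeffIdeal (J : TwoSidedIdeal (CrossedProduct α)) (n : ℕ) (c : ℤ) : TwoSidedIdeal R :=
  .mk' ((bounded J n).map (coeff α c)) (AddSubgroup.zero_mem _) (AddSubgroup.add_mem _)
    (AddSubgroup.neg_mem _)
    (by
      rintro a _ ⟨x, hx, rfl⟩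
      exact ⟨_, mono_mul_mem_bounded hx a, by rw [coeff_mono_mul, sub_zero, autPow_zero]⟩)
    (by
      rintro _ b ⟨x, hx, rfl⟩
      exact ⟨_, mul_mono_mem_bounded hx (autPow α (-c) b), by
        rw [coeff_mul_mono, sub_zero, autPow_autPow_neg]⟩)

theorem mem_coeffIdeal {c : ℤ} {r : R} :
    r ∈ coeffIdeal J n c ↔ ∃ x ∈ bounded J n, coeff α c x = r :=
  TwoSidedIdeal.mem_mk' _ _ _ _ _ _ _

theorem isStronglyInvariant_coeffIdeal (hR : HasLocalUnits R) (c : ℤ) :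
    IsStronglyInvariant (α : R →ₙ+* R) (coeffIdeal J n c) := by
  refine isStronglyInvariant_of_symm_mem (fun r hr => ?_) fun r hr => ?_ <;>
    obtain ⟨x, hx, rfl⟩ := mem_coeffIdeal.1 hr
  · obtain ⟨y, hy, hyc⟩ := exists_mem_bounded_coeff_eq hR hx 1
    exact mem_coeffIdeal.2 ⟨y, hy, by rw [hyc, autPow_one]⟩
  · obtain ⟨y, hy, hyc⟩ := exists_mem_bounded_coeff_eq hR hx (-1)
    exact mem_coeffIdeal.2 ⟨y, hy, by rw [hyc, autPow_neg_one]⟩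

/-- If evaluation of the degree `c` coefficient is injective on the elements of `J` supported in
`[0, n]`, and there are such elements apart from `0`, then it is a bijection onto `R`. -/
theorem bijective_coeff_bounded (hR : HasLocalUnits R)
    (hinv : ∀ I : TwoSidedIdeal R, IsStronglyInvariant (α : R →ₙ+* R) I → I = ⊥ ∨ I = ⊤)
    {c : ℤ} (hc : ∀ y ∈ bounded J n, coeff α c y = 0 → y = 0) (hx : x ∈ bounded J n)
    (hx0 : x ≠ 0) : Function.Bijective ((coeff α c).comp (bounded J n).subtype) := by
  refine ⟨(injective_iff_map_eq_zero _).2 fun y hy => Subtype.ext (hc y y.2 hy), fun r => ?_⟩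
  have htop : coeffIdeal J n c = ⊤ := by
    refine (hinv _ (isStronglyInvariant_coeffIdeal hR c)).resolve_left fun hb => hx0 (hc x hx ?_)
    rw [← TwoSidedIdeal.mem_bot, ← hb, mem_coeffIdeal]
    exact ⟨x, hx, rfl⟩
  have hr : r ∈ coeffIdeal J n c := htop ▸ TwoSidedIdeal.mem_top _
  obtain ⟨y, hy, rfl⟩ := mem_coeffIdeal.1 hr
  exact ⟨⟨y, hy⟩, rfl⟩

theorem exists_mem_bounded_ne_zero (hR : HasLocalUnits R) (hJ : J ≠ ⊥) :
    ∃ n, ∃ x ∈ bounded J n, x ≠ 0 := by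
  obtain ⟨x, hx, hx0⟩ : ∃ x ∈ J, x ≠ 0 := by
    contrapose! hJ
    refine TwoSidedIdeal.ext fun x => ?_
    rw [TwoSidedIdeal.mem_bot]
    exact ⟨hJ x, fun h => h ▸ J.zero_mem⟩
  obtain ⟨L, M, hL, -, hz⟩ := exists_lowest_highest hx0
  obtain ⟨y, hy, hyc⟩ := exists_mem_coeff_eq hR hx 0 (-L)
  refine ⟨(M - L).toNat, y, ⟨hy, fun m hm => ?_⟩, ?_⟩
  · rw [hyc, autPow_zero]
    by_contra h0
    have := hz _ h0
    omega
  · rintro rfl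
    have h0 := hyc 0
    rw [map_zero, autPow_zero, zero_sub, neg_neg] at h0
    exact hL h0.symm

theorem eq_top_of_mono_mem (hR : HasLocalUnits R) (h : ∀ r, mono α 0 r ∈ J) : J = ⊤ := by
  refine TwoSidedIdeal.ext fun x => ⟨fun _ => TwoSidedIdeal.mem_top _, fun _ => ?_⟩
  obtain ⟨e, he⟩ := hR.exists_common_unit x fun _ => RingEquiv.refl R
  have hx : mono α 0 e * x = x := ext_coeff fun m => by
    rw [coeff_mono_mul, sub_zero, autPow_zero]
    exact (he m).1
  rw [← hx]
  exact J.mul_mem_right _ _ (h e)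

/-- If the coefficients in degrees `0` and `n` both identify the elements of `J` supported in
`[0, n]` with `R`, then the passage from the lowest to the highest coefficient is a twist. -/
theorem exists_isTwist_of_bijective (hR : HasLocalUnits R)
    (h0 : Function.Bijective ((coeff α 0).comp (bounded J n).subtype))
    (hn : Function.Bijective ((coeff α n).comp (bounded J n).subtype)) :
    ∃ h : R ≃+ R, IsTwist α n h := by
  let h : R ≃+ R := (AddEquiv.ofBijective _ h0).symm.trans (AddEquiv.ofBijective _ hn)
  have hh : ∀ x ∈ bounded J n, h (coeff α 0 x) = coeff α n x := fun x hx =>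
    congrArg (AddEquiv.ofBijective _ hn) ((AddEquiv.ofBijective _ h0).symm_apply_apply ⟨x, hx⟩)
  have hs : ∀ r, ∃ x ∈ bounded J n, coeff α 0 x = r := fun r => by
    obtain ⟨⟨x, hx⟩, hxr⟩ := h0.2 r
    exact ⟨x, hx, hxr⟩
  refine ⟨h, fun r s => ?_, fun r s => ?_, fun r => ?_⟩
  · obtain ⟨x, hx, rfl⟩ := hs s
    have := hh _ (mono_mul_mem_bounded hx r)
    simp only [coeff_mono_mul, sub_zero, autPow_zero] at this
    rw [this, hh x hx]
  · obtain ⟨x, hx, rfl⟩ := hs r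
    have := hh _ (mul_mono_mem_bounded hx s)
    simp only [coeff_mul_mono, sub_zero, autPow_zero] at this
    rw [this, hh x hx]
  · obtain ⟨x, hx, rfl⟩ := hs r
    obtain ⟨y, hy, hyc⟩ := exists_mem_bounded_coeff_eq hR hx 1
    have := hh y hy
    rwa [hyc, hyc, autPow_one, autPow_one, ← hh x hx] at this

theorem isSimpleRing_of_isOuter (hR : HasLocalUnits R) (hα : IsOuter (α : R →ₙ+* R))
    (hinv : ∀ I : TwoSidedIdeal R, IsStronglyInvariant (α : R →ₙ+* R) I → I = ⊥ ∨ I = ⊤) :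
    IsSimpleRing (CrossedProduct α) := by
  have := hα.nontrivial
  have : Nontrivial (CrossedProduct α) := inferInstanceAs (Nontrivial (ℤ →₀ R))
  refine ⟨⟨fun J => or_iff_not_imp_left.2 fun hJ => ?_⟩⟩
  classical
  obtain ⟨n, ⟨x, hx, hx0⟩, hmin⟩ :
      ∃ n, (∃ x ∈ bounded J n, x ≠ 0) ∧ ∀ k < n, ∀ y ∈ bounded J k, y = 0 := by
    have hex := exists_mem_bounded_ne_zero hR hJ
    refine ⟨Nat.find hex, Nat.find_spec hex, fun k hk y hy => ?_⟩
    by_contra hy0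
    exact Nat.find_min hex hk ⟨y, hy, hy0⟩
  have hlow : ∀ y ∈ bounded J n, coeff α 0 y = 0 → y = 0 := fun y hy hy0 => by
    -- Dividing by `t` gives an element supported in `[0, n - 1]`.
    obtain ⟨z, hz, hzc⟩ := exists_mem_coeff_eq hR hy.1 0 (-1)
    have hyz : ∀ m, coeff α m y = coeff α (m - 1) z := fun m => by
      rw [hzc, autPow_zero, sub_neg_eq_add, sub_add_cancel]
    have hz' : ∀ m : ℤ, m < 0 ∨ n ≤ m → coeff α m z = 0 := fun m hm => by
      rw [hzc, autPow_zero, sub_neg_eq_add]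
      rcases eq_or_ne (m + 1) 0 with h | h
      · rw [h, hy0]
      · exact hy.2 _ (by omega)
    suffices z = 0 from ext_coeff fun m => by rw [hyz, this, map_zero, map_zero]
    rcases Nat.eq_zero_or_pos n with rfl | hn
    · refine ext_coeff fun m => ?_
      rw [hz' m (by omega), map_zero]
    · exact hmin (n - 1) (by omega) z ⟨hz, fun m hm => hz' m (by omega)⟩
  have hbij0 := bijective_coeff_bounded hR hinv hlow hx hx0
  rcases Nat.eq_zero_or_pos n with rfl | hn
  · refine eq_top_of_mono_mem hR fun r => ?_
    obtain ⟨⟨y, hy⟩, rfl⟩ := hbij0.2 r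
    change mono α 0 (coeff α 0 y) ∈ J
    convert hy.1 using 1
    refine ext_coeff fun m => ?_
    rw [coeff_mono]
    split_ifs with hm
    · rw [hm]
    · exact (hy.2 m (by omega)).symm
  · have hhigh : ∀ y ∈ bounded J n, coeff α n y = 0 → y = 0 := fun y hy hyn =>
      hmin (n - 1) (by omega) y ⟨hy.1, fun m hm => by
        rcases eq_or_ne m n with h | h
        · rw [h, hyn]
        · exact hy.2 m (by omega)⟩
    obtain ⟨h, hh⟩ := exists_isTwist_of_bijective hR hbij0
      (bijective_coeff_bounded hR hinv hhigh hx hx0)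
    exact absurd hh.isInnerWithPeriodicity (hα n hn)

end CrossedProduct

end LocalUnitsRing

theorem corollary8p9 {R : Type*} [NonUnitalRing R]
    (hR : LocalUnitsRing.HasLocalUnits R) (α : R ≃+* R) :
    IsSimpleRing (LocalUnitsRing.CrossedProduct α) ↔
      LocalUnitsRing.IsOuter (α : R →ₙ+* R) ∧
        ∀ I : TwoSidedIdeal R,
          LocalUnitsRing.IsStronglyInvariant (α : R →ₙ+* R) I → I = ⊥ ∨ I = ⊤ := by
  refine ⟨fun hS => ⟨fun n hn hα => ?_, ?_⟩, fun h => ?_⟩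
  · obtain ⟨h, hh⟩ := hα.exists_isTwist hR
    have : Nontrivial R := by
      by_contra hR'
      rw [not_nontrivial_iff_subsingleton] at hR'
      -- Over the zero ring the crossed product is zero, so it has only one ideal.
      refine bot_ne_top (α := TwoSidedIdeal (LocalUnitsRing.CrossedProduct α)) ?_
      refine TwoSidedIdeal.ext fun x => ⟨fun _ => TwoSidedIdeal.mem_top _, fun _ => ?_⟩
      exact LocalUnitsRing.CrossedProduct.ext_coeff fun m => Subsingleton.elim _ _
    exact hh.not_isSimpleRing hn hS
  · exact LocalUnitsRing.CrossedProduct.eq_bot_or_eq_top_of_isSimpleRing hR hS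
  · exact LocalUnitsRing.CrossedProduct.isSimpleRing_of_isOuter hR h.1 h.2
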